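/- Let $p=p_1\cdots p_k$ be a pattern, i.e. a finite word over an alphabet of variables, in which exactly $r$ distinct variables occur, the $j$th one $k_j\ge 1$ times, numbered so that $1=k_1=\cdots=k_s<k_{s+1}\le\cdots\le k_r$ (so $s$ is the number of variables that occur exactly once, and $k=k_1+\cdots+k_r$). For a word $w$ over an alphabet $\mathcal A$, the number of occurrences of $p$ in $w$ in the abelian sense is the sum, over all sequences $(u_1,\ldots,u_k)$ of nonempty words over $\mathcal A$ such that $u_i$ is a rearrangement of the letters of $u_j$ whenever $p_i=p_j$, of the number of positions at which the concatenation $u_1\cdots u_k$ occurs as a factor of $w$. Let $m\ge 4$, let $|\mathcal A|=m$, and let $\widehat\Omega_n$ be the mean of this number over all $m^n$ words $w$ of length $n$ over $\mathcal A$, each being equally likely. Then, for every $j$ with $s<j\le r$, the series $$\sum_{\ell=1}^{\infty}\frac{1}{m^{k_j\ell}}\sum_{i_1+\cdots+i_m=\ell}\binom{\ell}{i_1,\ldots,i_m}^{k_j}$$ (the inner sum being over nonnegative integers $i_1,\ldots,i_m$) converges, and, as $n\to\infty$, $$\widehat{\Omega}_n\sim\frac{n^{s+1}}{(s+1)!}\prod_{j=s+1}^r\left[\sum_{\ell=1}^{\infty}\frac{1}{m^{k_j\ell}}\sum_{i_1+\cdots+i_m=\ell}\binom{\ell}{i_1,\ldots,i_m}^{k_j}\right].$$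 -/

import Mathlib

/-- The number of times the word `v` occurs as a factor of the word `w`, i.e. the number of
positions `0 ≤ i ≤ |w|` such that `v` is a prefix of what remains of `w` after its first
`i` letters. -/
def factorCount {A : Type*} [DecidableEq A] (v w : List A) : ℕ :=
  ((Finset.range (w.length + 1)).filter (fun i => v <+: w.drop i)).card

/-- The sequence of words `u₁, …, u_k` is an abelian substitution instance of the pattern
`p = p₁ ⋯ p_k`: all `u_i` are nonempty, and `u_i` is a rearrangement of `u_j` whenever
`p_i = p_j`. -/
def IsAbelianInstance {V A : Type*} (p : List V) (u : Fin p.length → List A) : Prop :=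
  (∀ i, u i ≠ []) ∧ ∀ i j, p.get i = p.get j → (u i).Perm (u j)

/-- The number of occurrences of the pattern `p` in the word `w` in the abelian sense: the sum,
over all abelian instances `(u₁, …, u_k)` of `p`, of the number of times that the concatenation
`u₁ ⋯ u_k` occurs as a factor of `w`. Only finitely many terms are nonzero
(`finite_abelianInstances`). -/
noncomputable def abelianCount {V A : Type*} [DecidableEq A] (p : List V) (w : List A) : ℕ :=
  ∑ᶠ (u : Fin p.length → List A) (_ : IsAbelianInstance p u),
    factorCount (List.ofFn u).flatten w

theorem finite_abelianInstances {V A : Type*} [DecidableEq A] (p : List V) (w : List A) :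
    {u : Fin p.length → List A | factorCount (List.ofFn u).flatten w ≠ 0}.Finite := by
  refine (Set.Finite.pi' (t := fun _ => {x : List A | x ∈ w.sublists})
    (fun _ => List.finite_toSet _)).subset ?_
  intro u hu j
  obtain ⟨i, hi⟩ := Finset.card_ne_zero.mp hu
  have h := (Finset.mem_filter.mp hi).2
  rw [Set.mem_setOf_eq, List.mem_sublists]
  refine (List.sublist_flatten_of_mem ?_).trans (h.sublist.trans (List.drop_sublist i w))
  exact (List.mem_ofFn' _ _).mpr ⟨j, rfl⟩

/-- The mean, over all words of length `n` over the finite alphabet `A` (each being equally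
likely), of the number of occurrences of `p` in the abelian sense. -/
noncomputable def meanAbelianCount {V : Type*} (A : Type*) [Fintype A] [DecidableEq A]
    (p : List V) (n : ℕ) : ℝ :=
  (∑ w : Fin n → A, (abelianCount p (List.ofFn w) : ℝ)) / (Fintype.card A : ℝ) ^ n

/-- `m ^ (-kℓ) * ∑_{i₁ + ⋯ + i_m = ℓ} multinomial(ℓ; i₁, …, i_m) ^ k`. -/
noncomputable def abelianTerm (m k l : ℕ) : ℝ :=
  1 / (m : ℝ) ^ (k * l) *
    ∑ i ∈ Finset.piAntidiag (Finset.univ : Finset (Fin m)) l,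
      (Nat.multinomial Finset.univ i : ℝ) ^ k
/-!
A fixed word `v` occurs on average `(n + 1 - |v|) * m ^ (-|v|)` times in a random word of length
`n ≥ |v|`, so the mean is a sum of such terms over all abelian instances `u` of the pattern. The
weight `m ^ (-|u|)` is multiplicative, and being an instance only constrains the Parikh vectors of
the `uᵢ`. Grouping first by Parikh vectors and then by lengths turns the mean into a sum over one
length `ℓ ≥ 1` per variable, in which a variable that occurs `k` times carries the weight
`abelianTerm m k ℓ`, i.e. the probability that `k` independent random words of length `ℓ` are
rearrangements of each other.

For `k = 1` this weight is `1`, so the lengths of the `s` variables that occur once can be summed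
out; this turns `n + 1 - c` into the binomial coefficient `(n + 1 - c).choose (s + 1)`, where `c`
is the total length taken up by the other variables. After division by `n ^ (s + 1)` each term
tends to its weight divided by `(s + 1)!`, and dominated convergence applies once the weights are
summable.

By Stirling's formula any given Parikh vector of length `ℓ` has probability
`O(ℓ ^ (-(m - 1) / 2))`, whence `abelianTerm m k ℓ = O(ℓ ^ (-(m - 1) * (k - 1) / 2))`. This is
summable as soon as `(m - 1) * (k - 1) > 2`.
-/

open scoped ENNReal
open Filter Topology Asymptotics

section FinitePowers

theorem tsum_pi_prod_eq_prod_tsum {ι α : Type*} [Fintype ι] (f : ι → α → ℝ≥0∞) :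
    ∑' x : ι → α, ∏ i, f i (x i) = ∏ i, ∑' a, f i a := by
  revert f
  refine Fintype.induction_empty_option
    (P := fun ι _ => ∀ f : ι → α → ℝ≥0∞, ∑' x : ι → α, ∏ i, f i (x i) = ∏ i, ∑' a, f i a)
    (fun ι κ _ e ih f => ?of_equiv) (fun f => by simp) (fun ι _ ih f => ?option) ι
  case of_equiv =>
    let := Fintype.ofEquiv κ e.symm
    rw [← (e.arrowCongr (Equiv.refl α)).tsum_eq, ← e.prod_comp, ← ih]
    refine tsum_congr fun x => ?_
    rw [← e.prod_comp]
    simp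
  case option =>
    rw [← (Equiv.piOptionEquivProd (β := fun _ => α)).symm.tsum_eq, ENNReal.tsum_prod',
      Fintype.prod_option, ← ih, ← ENNReal.tsum_mul_right]
    refine tsum_congr fun a => ?_
    rw [← ENNReal.tsum_mul_left]
    simp [Fintype.prod_option, Equiv.piOptionEquivProd]

theorem tsum_pi_prod_mul_comp {ι α β : Type*} [Fintype ι] [DecidableEq β]
    (f : ι → α → ℝ≥0∞) (c : α → β) (G : (ι → β) → ℝ≥0∞) :
    ∑' x : ι → α, (∏ i, f i (x i)) * G (fun i => c (x i)) =
      ∑' y : ι → β, (∏ i, ∑' a, if c a = y i then f i a else 0) * G y := by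
  simp_rw [← tsum_pi_prod_eq_prod_tsum, ← ENNReal.tsum_mul_right]
  rw [ENNReal.tsum_comm]
  refine tsum_congr fun x => ?_
  rw [tsum_eq_single fun i => c (x i)]
  · simp only [if_true]
  · intro y hy
    obtain ⟨i, hi⟩ := Function.ne_iff.mp hy
    rw [Finset.prod_eq_zero (Finset.mem_univ i) (if_neg hi.symm), zero_mul]

open Classical in
theorem tsum_ite_factorsThrough {ι κ β : Type*} {π : ι → κ} (hπ : Function.Surjective π)
    (G : (ι → β) → ℝ≥0∞) :
    ∑' y : ι → β, (if y.FactorsThrough π then G y else 0) = ∑' x : κ → β, G (x ∘ π) := by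
  rw [← hπ.injective_comp_right.tsum_eq]
  · exact tsum_congr fun x => if_pos (Function.FactorsThrough.rfl.comp_left x)
  · intro y hy
    have hfac : y.FactorsThrough π := by_contra fun h => hy (if_neg h)
    exact ⟨y ∘ Function.surjInv hπ, funext fun i => hfac (Function.surjInv_eq hπ (π i))⟩

theorem hasSum_pi_prod {ι α : Type*} [Fintype ι] {t : ι → α → ℝ} (h0 : ∀ i a, 0 ≤ t i a)
    (ht : ∀ i, Summable (t i)) :
    HasSum (fun x : ι → α => ∏ i, t i (x i)) (∏ i, ∑' a, t i a) := by
  have hterm : ∀ x : ι → α, 0 ≤ ∏ i, t i (x i) := fun x => Finset.prod_nonneg fun i _ => h0 i _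
  have hE : ∑' x : ι → α, ENNReal.ofReal (∏ i, t i (x i)) =
      ENNReal.ofReal (∏ i, ∑' a, t i a) := by
    rw [ENNReal.ofReal_prod_of_nonneg fun i _ => tsum_nonneg (h0 i)]
    simp_rw [ENNReal.ofReal_tsum_of_nonneg (h0 _) (ht _), ← tsum_pi_prod_eq_prod_tsum,
      ENNReal.ofReal_prod_of_nonneg fun i _ => h0 i _]
  have hsum : Summable fun x : ι → α => ∏ i, t i (x i) :=
    (ENNReal.summable_toReal (hE ▸ ENNReal.ofReal_ne_top)).congr fun x =>
      ENNReal.toReal_ofReal (hterm x)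
  rw [← ENNReal.ofReal_tsum_of_nonneg hterm hsum, ENNReal.ofReal_eq_ofReal_iff
    (tsum_nonneg hterm) (Finset.prod_nonneg fun i _ => tsum_nonneg (h0 i))] at hE
  exact hE ▸ hsum.hasSum

end FinitePowers

section Words

theorem sum_pi_fin_succ {A M : Type*} [Fintype A] [AddCommMonoid M] {n : ℕ}
    (g : (Fin (n + 1) → A) → M) :
    ∑ w, g w = ∑ a, ∑ w : Fin n → A, g (Fin.cons a w) := by
  rw [← (Fin.consEquiv fun _ => A).sum_comp, Fintype.sum_prod_type]
  rfl

variable {A : Type*} [DecidableEq A]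

theorem factorCount_cons (v : List A) (a : A) (w : List A) :
    factorCount v (a :: w) = (if v <+: a :: w then 1 else 0) + factorCount v w := by
  simp only [factorCount, Finset.card_filter, List.length_cons]
  rw [Finset.sum_range_succ', add_comm]
  simp only [List.drop_succ_cons, List.drop_zero]

theorem sum_ite_isPrefix_ofFn [Fintype A] (v : List A) (n : ℕ) :
    (∑ w : Fin n → A, if v <+: List.ofFn w then 1 else 0) =
      if v.length ≤ n then Fintype.card A ^ (n - v.length) else 0 := by
  induction v generalizing n with
  | nil => simp
  | cons a v ih =>
    cases n with
    | zero => simp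
    | succ n =>
      rw [sum_pi_fin_succ, Fintype.sum_eq_single a fun b hb => by
        simp [List.ofFn_succ, List.cons_prefix_cons, hb.symm]]
      simp [List.ofFn_succ, List.cons_prefix_cons, ih n]

theorem sum_factorCount_ofFn [Fintype A] (v : List A) (n : ℕ) :
    ∑ w : Fin n → A, factorCount v (List.ofFn w) =
      (n + 1 - v.length) * Fintype.card A ^ (n - v.length) := by
  induction n with
  | zero => cases v <;> simp [factorCount]
  | succ n ih =>
    have hrec : ∑ w : Fin (n + 1) → A, factorCount v (List.ofFn w) =
        (if v.length ≤ n + 1 then Fintype.card A ^ (n + 1 - v.length) else 0) +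
          Fintype.card A * ((n + 1 - v.length) * Fintype.card A ^ (n - v.length)) := by
      simp_rw [List.ofFn_succ, factorCount_cons, Finset.sum_add_distrib, ← List.ofFn_succ]
      rw [sum_ite_isPrefix_ofFn, sum_pi_fin_succ]
      simp [ih]
    rw [hrec]
    rcases lt_trichotomy v.length (n + 1) with h | h | h
    · rw [if_pos h.le, show n + 1 + 1 - v.length = n + 1 - v.length + 1 by omega,
        show n + 1 - v.length = n - v.length + 1 by omega]
      ring
    · simp [h]
    · rw [if_neg h.not_ge, Nat.sub_eq_zero_of_le h.le, Nat.sub_eq_zero_of_le (m := v.length) h]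
      simp

/-- The Parikh vector of a word: the number of occurrences of each letter. Two words are
rearrangements of each other if and only if their Parikh vectors agree. -/
def parikh (w : List A) : A → ℕ := fun a => w.count a

theorem parikh_eq_iff_perm {u w : List A} : parikh u = parikh w ↔ u.Perm w := by
  rw [List.perm_iff_count]
  exact funext_iff

theorem sum_parikh [Fintype A] (w : List A) : ∑ a, parikh w a = w.length := by
  simpa [parikh] using Multiset.sum_count_eq_card (s := Finset.univ) (m := (w : Multiset A))

theorem parikh_eq_zero_iff {w : List A} : parikh w = 0 ↔ w = [] := by
  rw [← List.perm_nil, ← parikh_eq_iff_perm]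
  exact Iff.of_eq (congrArg _ (funext fun a => (List.count_nil (a := a)).symm))

theorem prod_map_X_eq_monomial_parikh [Finite A] (w : List A) :
    (w.map (MvPolynomial.X (R := ℕ))).prod =
      MvPolynomial.monomial (Finsupp.equivFunOnFinite.symm (parikh w)) 1 := by
  induction w with
  | nil =>
    have hnil : Finsupp.equivFunOnFinite.symm (parikh ([] : List A)) = 0 :=
      Finsupp.ext fun a => List.count_nil (a := a)
    rw [hnil]
    rfl
  | cons a w ih =>
    rw [List.map_cons, List.prod_cons, ih, MvPolynomial.X, MvPolynomial.monomial_mul, one_mul]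
    refine congrArg (MvPolynomial.monomial · 1) (Finsupp.ext fun b => ?_)
    simp [parikh, List.count_cons, Finsupp.single_apply, add_comm]

theorem sum_ite_parikh_ofFn [Fintype A] (x : A → ℕ) (n : ℕ) :
    (∑ w : Fin n → A, if parikh (List.ofFn w) = x then 1 else 0) =
      if ∑ a, x a = n then Nat.multinomial Finset.univ x else 0 := by
  -- Both sides are the coefficient of `X ^ x` in `(∑ a, X a) ^ n`.
  have h := MvPolynomial.coeff_sum_X_pow_of_fintype (R := ℕ) (Finsupp.equivFunOnFinite.symm x) n
  rw [Finset.sum_pow', MvPolynomial.coeff_sum, Fintype.piFinset_univ,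
    Finsupp.multinomial_eq_of_support_subset (Finset.subset_univ _),
    Finsupp.sum_fintype _ _ (by simp)] at h
  have hmonomial : ∀ w : Fin n → A, ∏ i, (MvPolynomial.X (w i) : MvPolynomial A ℕ) =
      MvPolynomial.monomial (Finsupp.equivFunOnFinite.symm (parikh (List.ofFn w))) 1 := fun w => by
    rw [← prod_map_X_eq_monomial_parikh, List.map_ofFn, List.prod_ofFn]
    rfl
  simpa [hmonomial, MvPolynomial.coeff_monomial] using h

theorem tsum_ite_parikh_eq [Fintype A] (x : A → ℕ) :
    (∑' w : List A, if parikh w = x then (1 : ℝ≥0∞) else 0) =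
      Nat.multinomial Finset.univ x := by
  have hlength : ∀ n, (∑' w : Fin n → A, if parikh (List.ofFn w) = x then (1 : ℝ≥0∞) else 0) =
      if ∑ a, x a = n then (Nat.multinomial Finset.univ x : ℝ≥0∞) else 0 := fun n => by
    rw [tsum_fintype]
    exact_mod_cast congrArg (Nat.cast (R := ℝ≥0∞)) (sum_ite_parikh_ofFn x n)
  rw [← List.equivSigmaTuple.symm.tsum_eq, ENNReal.tsum_sigma']
  exact (tsum_congr hlength).trans (tsum_ite_eq' _ _)

end Words

section ParikhProb

variable {ι : Type*} [Fintype ι]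

/-- The probability that a uniformly random word over the alphabet `ι` has Parikh vector `x`,
among the words of the only possible length `∑ a, x a`. -/
noncomputable def parikhProb (x : ι → ℕ) : ℝ :=
  Nat.multinomial Finset.univ x / (Fintype.card ι : ℝ) ^ (∑ a, x a)

theorem parikhProb_nonneg (x : ι → ℕ) : 0 ≤ parikhProb x := by
  unfold parikhProb
  positivity

theorem parikhProb_pos [Nonempty ι] (x : ι → ℕ) : 0 < parikhProb x := by
  have := Nat.multinomial_pos Finset.univ x
  have := Fintype.card_pos (α := ι)
  unfold parikhProb
  positivity

theorem parikhProb_comp_equiv {κ : Type*} [Fintype κ] (e : ι ≃ κ) (x : κ → ℕ) :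
    parikhProb (x ∘ e) = parikhProb x := by
  simp only [parikhProb, Nat.multinomial, Function.comp_apply, Fintype.card_congr e,
    e.sum_comp x, e.prod_comp fun a => (x a).factorial]

theorem sum_piAntidiag_parikhProb [DecidableEq ι] [Nonempty ι] (l : ℕ) :
    ∑ x ∈ Finset.piAntidiag (Finset.univ : Finset ι) l, parikhProb x = 1 := by
  have hpow := Finset.sum_pow_eq_sum_piAntidiag (Finset.univ : Finset ι) (fun _ => (1 : ℝ)) l
  simp only [Finset.sum_const, Finset.card_univ, nsmul_eq_mul, mul_one, one_pow,
    Finset.prod_const_one] at hpow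
  calc
    _ = ∑ x ∈ Finset.piAntidiag (Finset.univ : Finset ι) l,
        (Nat.multinomial Finset.univ x : ℝ) / (Fintype.card ι : ℝ) ^ l :=
      Finset.sum_congr rfl fun x hx => by rw [parikhProb, (Finset.mem_piAntidiag.mp hx).1]
    _ = 1 := by rw [← Finset.sum_div, ← hpow, div_self (by positivity)]

theorem tsum_ite_parikh_eq_parikhProb [DecidableEq ι] [Nonempty ι] (x : ι → ℕ) :
    (∑' w : List ι, if parikh w = x then (Fintype.card ι : ℝ≥0∞)⁻¹ ^ w.length else 0) =
      ENNReal.ofReal (parikhProb x) := by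
  have hterm : ∀ w : List ι,
      (if parikh w = x then (Fintype.card ι : ℝ≥0∞)⁻¹ ^ w.length else 0) =
        (if parikh w = x then 1 else 0) * (Fintype.card ι : ℝ≥0∞)⁻¹ ^ (∑ a, x a) := fun w => by
    by_cases h : parikh w = x
    · rw [if_pos h, if_pos h, ← h, sum_parikh, one_mul]
    · rw [if_neg h, if_neg h, zero_mul]
  have hcard : (0 : ℝ) < Fintype.card ι := Nat.cast_pos.mpr Fintype.card_pos
  simp_rw [hterm]
  rw [ENNReal.tsum_mul_right, tsum_ite_parikh_eq, parikhProb,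
    ENNReal.ofReal_div_of_pos (pow_pos hcard _), ENNReal.ofReal_pow hcard.le,
    ENNReal.ofReal_natCast, ENNReal.ofReal_natCast, div_eq_mul_inv, ENNReal.inv_pow]

theorem abelianTerm_eq_sum_parikhProb_pow [DecidableEq ι] (k l : ℕ) :
    abelianTerm (Fintype.card ι) k l =
      ∑ x ∈ Finset.piAntidiag (Finset.univ : Finset ι) l, parikhProb x ^ k := by
  have hfin : abelianTerm (Fintype.card ι) k l =
      ∑ x ∈ Finset.piAntidiag (Finset.univ : Finset (Fin (Fintype.card ι))) l,
        parikhProb x ^ k := by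
    rw [abelianTerm, Finset.mul_sum]
    refine Finset.sum_congr rfl fun x hx => ?_
    rw [parikhProb, (Finset.mem_piAntidiag.mp hx).1, Fintype.card_fin, div_pow, ← pow_mul',
      one_div_mul_eq_div]
  have e := Fintype.equivFin ι
  rw [hfin]
  refine Finset.sum_bij' (fun x _ => x ∘ e) (fun x _ => x ∘ e.symm) ?_ ?_ ?_ ?_ ?_
  · intro x hx
    simpa [e.sum_comp x] using hx
  · intro x hx
    simpa [e.symm.sum_comp x] using hx
  · intro x _
    simp [Function.comp_assoc]
  · intro x _
    simp [Function.comp_assoc]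
  · intro x _
    rw [parikhProb_comp_equiv]

theorem tsum_ite_sum_eq_parikhProb_pow (k l : ℕ) :
    (∑' x : ι → ℕ, if ∑ a, x a = l then ENNReal.ofReal (parikhProb x) ^ k else 0) =
      ENNReal.ofReal (abelianTerm (Fintype.card ι) k l) := by
  classical
  rw [abelianTerm_eq_sum_parikhProb_pow,
    ENNReal.ofReal_sum_of_nonneg fun x _ => pow_nonneg (parikhProb_nonneg x) k,
    tsum_eq_sum (s := Finset.piAntidiag Finset.univ l)]
  · refine Finset.sum_congr rfl fun x hx => ?_
    rw [if_pos (Finset.mem_piAntidiag.mp hx).1, ENNReal.ofReal_pow (parikhProb_nonneg x)]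
  · exact fun x hx => if_neg fun h => hx (Finset.mem_piAntidiag.mpr ⟨h, by simp⟩)

theorem abelianTerm_nonneg (m k l : ℕ) : 0 ≤ abelianTerm m k l := by
  unfold abelianTerm
  positivity

theorem abelianTerm_eq_sum_fin (m k l : ℕ) : abelianTerm m k l =
    ∑ x ∈ Finset.piAntidiag (Finset.univ : Finset (Fin m)) l, parikhProb x ^ k := by
  rw [← abelianTerm_eq_sum_parikhProb_pow, Fintype.card_fin]

theorem abelianTerm_one (m l : ℕ) [NeZero m] : abelianTerm m 1 l = 1 := by
  simp only [abelianTerm_eq_sum_fin, pow_one, sum_piAntidiag_parikhProb]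

theorem abelianTerm_pos (m k l : ℕ) [NeZero m] : 0 < abelianTerm m k l := by
  rw [abelianTerm_eq_sum_fin]
  exact Finset.sum_pos (fun x _ => pow_pos (parikhProb_pos x) k)
    ⟨Pi.single 0 l, by simp⟩

theorem abelianTerm_succ_le_pow {m k l : ℕ} [NeZero m] {b : ℝ}
    (hb : ∀ x : Fin m → ℕ, ∑ a, x a = l → parikhProb x ≤ b) :
    abelianTerm m (k + 1) l ≤ b ^ k := by
  calc
    abelianTerm m (k + 1) l
      ≤ ∑ x ∈ Finset.piAntidiag (Finset.univ : Finset (Fin m)) l, b ^ k * parikhProb x := by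
        rw [abelianTerm_eq_sum_fin]
        refine Finset.sum_le_sum fun x hx => ?_
        rw [pow_succ]
        gcongr
        · exact parikhProb_nonneg x
        · exact parikhProb_nonneg x
        · exact hb x (Finset.mem_piAntidiag.mp hx).1
    _ = b ^ k := by rw [← Finset.mul_sum, sum_piAntidiag_parikhProb, mul_one]

end ParikhProb

section PatternVariables

variable {V A : Type*} [DecidableEq V]

/-- The variable at a given position of a pattern, as an element of the set of variables that
occur in the pattern. -/
def patternVar (p : List V) (i : Fin p.length) : p.toFinset :=
  ⟨p.get i, List.mem_toFinset.mpr (p.get_mem i)⟩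

theorem patternVar_surjective (p : List V) : Function.Surjective (patternVar p) := fun v => by
  obtain ⟨i, hi⟩ := List.mem_iff_get.mp (List.mem_toFinset.mp v.2)
  exact ⟨i, Subtype.ext hi⟩

@[to_additive]
theorem prod_patternVar {M : Type*} [CommMonoid M] (p : List V) (F : p.toFinset → M) :
    ∏ i, F (patternVar p i) = ∏ v : p.toFinset, F v ^ p.count v.1 := by
  have hlist : ∀ f : V → M, ∏ i, f (p.get i) = ∏ v ∈ p.toFinset, f v ^ p.count v := fun f => by
    rw [← Finset.prod_list_map_count, ← List.prod_ofFn]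
    exact congrArg _ (by simp)
  simp_rw [← Subtype.val_injective.extend_apply F 1]
  exact (hlist _).trans (Finset.prod_coe_sort _ _).symm

theorem isAbelianInstance_iff [DecidableEq A] (p : List V) (u : Fin p.length → List A) :
    IsAbelianInstance p u ↔
      (fun i => parikh (u i)).FactorsThrough (patternVar p) ∧ ∀ i, parikh (u i) ≠ 0 := by
  simp only [IsAbelianInstance, Function.FactorsThrough, patternVar, Subtype.mk.injEq,
    parikh_eq_iff_perm, ne_eq, parikh_eq_zero_iff, and_comm]

end PatternVariables

section Mean

variable {V A : Type*} [Fintype A]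

open Classical in
theorem abelianCount_eq_tsum {A : Type*} [DecidableEq A] (p : List V) (w : List A) :
    (abelianCount p w : ℝ≥0∞) = ∑' u : Fin p.length → List A,
      if IsAbelianInstance p u then (factorCount (List.ofFn u).flatten w : ℝ≥0∞) else 0 := by
  let F (u : Fin p.length → List A) : ℕ :=
    if IsAbelianInstance p u then factorCount (List.ofFn u).flatten w else 0
  have hcount : abelianCount p w = ∑ᶠ u, F u := finsum_congr fun u => finsum_eq_if
  have hfin : F.support.Finite :=
    (finite_abelianInstances p w).subset fun u hu h => hu (by simp only [F, h, ite_self])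
  have hcast : ∀ u, (F u : ℝ≥0∞) =
      if IsAbelianInstance p u then (factorCount (List.ofFn u).flatten w : ℝ≥0∞) else 0 :=
    fun u => by simp only [F, Nat.cast_ite, Nat.cast_zero]
  simp_rw [hcount, finsum_eq_sum _ hfin, Nat.cast_sum, ← hcast]
  rw [tsum_eq_sum (s := hfin.toFinset) fun u hu => by simpa using hu]

theorem sum_factorCount_div_pow [DecidableEq A] [Nonempty A] (v : List A) (n : ℕ) :
    (∑ w : Fin n → A, (factorCount v (List.ofFn w) : ℝ≥0∞)) / (Fintype.card A : ℝ≥0∞) ^ n =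
      (Fintype.card A : ℝ≥0∞)⁻¹ ^ v.length * (n + 1 - v.length : ℕ) := by
  rw [← Nat.cast_sum, sum_factorCount_ofFn]
  by_cases hv : v.length ≤ n
  · have hpow : (Fintype.card A : ℝ≥0∞) ^ n =
        (Fintype.card A : ℝ≥0∞) ^ (n - v.length) * (Fintype.card A : ℝ≥0∞) ^ v.length := by
      rw [← pow_add, Nat.sub_add_cancel hv]
    rw [hpow, Nat.cast_mul, Nat.cast_pow, mul_comm, ENNReal.mul_div_mul_left _ _
      (by simp) (by finiteness), div_eq_mul_inv, mul_comm, ENNReal.inv_pow]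
  · simp [Nat.sub_eq_zero_of_le (not_le.mp hv)]

open Classical in
theorem ofReal_meanAbelianCount [DecidableEq A] [Nonempty A] (p : List V) (n : ℕ) :
    ENNReal.ofReal (meanAbelianCount A p n) = ∑' u : Fin p.length → List A,
      if IsAbelianInstance p u then (∏ i, (Fintype.card A : ℝ≥0∞)⁻¹ ^ (u i).length) *
        (n + 1 - ∑ i, (u i).length : ℕ) else 0 := by
  have hcard : (0 : ℝ) < Fintype.card A := Nat.cast_pos.mpr Fintype.card_pos
  rw [meanAbelianCount, ENNReal.ofReal_div_of_pos (pow_pos hcard n),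
    ENNReal.ofReal_sum_of_nonneg fun _ _ => Nat.cast_nonneg _, ENNReal.ofReal_pow hcard.le]
  simp only [ENNReal.ofReal_natCast, abelianCount_eq_tsum]
  rw [← Summable.tsum_finsetSum fun _ _ => ENNReal.summable, div_eq_mul_inv,
    ← ENNReal.tsum_mul_right]
  refine tsum_congr fun u => ?_
  split_ifs
  · rw [← div_eq_mul_inv, sum_factorCount_div_pow, Finset.prod_pow_eq_pow_sum,
      List.length_flatten, List.map_ofFn, List.sum_ofFn]
    rfl
  · simp

open Classical in
theorem tsum_isAbelianInstance_eq_tsum_parikh [DecidableEq V] [Nonempty A] (p : List V)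
    (g : ℕ → ℝ≥0∞) :
    (∑' u : Fin p.length → List A, if IsAbelianInstance p u then
      (∏ i, (Fintype.card A : ℝ≥0∞)⁻¹ ^ (u i).length) * g (∑ i, (u i).length) else 0) =
      ∑' x : p.toFinset → A → ℕ, if ∀ v, x v ≠ 0 then
        (∏ v, ENNReal.ofReal (parikhProb (x v)) ^ p.count v.1) *
          g (∑ v, p.count v.1 * ∑ a, x v a) else 0 := by
  classical
  let G (y : Fin p.length → A → ℕ) : ℝ≥0∞ := if ∀ i, y i ≠ 0 then g (∑ i, ∑ a, y i a) else 0
  calc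
    _ = ∑' u : Fin p.length → List A, (∏ i, (Fintype.card A : ℝ≥0∞)⁻¹ ^ (u i).length) *
        (fun y : Fin p.length → A → ℕ => if y.FactorsThrough (patternVar p) then G y else 0)
          fun i => parikh (u i) := by
      refine tsum_congr fun u => ?_
      simp only [G, isAbelianInstance_iff, sum_parikh, ite_and, mul_ite, mul_zero]
    _ = ∑' y : Fin p.length → A → ℕ, if y.FactorsThrough (patternVar p) then
        (∏ i, ENNReal.ofReal (parikhProb (y i))) * G y else 0 := by
      refine (tsum_pi_prod_mul_comp (fun _ w => (Fintype.card A : ℝ≥0∞)⁻¹ ^ w.length)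
        parikh fun y => if y.FactorsThrough (patternVar p) then G y else 0).trans ?_
      simp only [tsum_ite_parikh_eq_parikhProb, mul_ite, mul_zero]
    _ = ∑' x : p.toFinset → A → ℕ, (∏ i, ENNReal.ofReal (parikhProb (x (patternVar p i)))) *
        G (x ∘ patternVar p) :=
      tsum_ite_factorsThrough (patternVar_surjective p) _
    _ = _ := by
      refine tsum_congr fun x => ?_
      have hsum := sum_patternVar p fun v => ∑ a, x v a
      have hforall := (patternVar_surjective p).forall (p := fun v => x v ≠ 0)
      simp only [smul_eq_mul] at hsum
      rw [prod_patternVar p fun v => ENNReal.ofReal (parikhProb (x v)), ← hsum, if_congr hforall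
        rfl rfl, ← mul_ite_zero]
      rfl

open Classical in
theorem tsum_parikh_eq_tsum_length [DecidableEq V] (p : List V) (g : ℕ → ℝ≥0∞) :
    (∑' x : p.toFinset → A → ℕ, if ∀ v, x v ≠ 0 then
      (∏ v, ENNReal.ofReal (parikhProb (x v)) ^ p.count v.1) *
        g (∑ v, p.count v.1 * ∑ a, x v a) else 0) =
      ∑' d : p.toFinset → ℕ,
        (∏ v, ENNReal.ofReal (abelianTerm (Fintype.card A) (p.count v.1) (d v + 1))) *
          g (∑ v, p.count v.1 * (d v + 1)) := by
  let f (v : p.toFinset) (x : A → ℕ) : ℝ≥0∞ :=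
    if x ≠ 0 then ENNReal.ofReal (parikhProb x) ^ p.count v.1 else 0
  have hzero : ∀ x : A → ℕ, x = 0 ↔ ∑ a, x a = 0 := fun x => by simp [funext_iff]
  have hfiber : ∀ (v : p.toFinset) (l : ℕ), (∑' x, if ∑ a, x a = l then f v x else 0) =
      if l = 0 then 0 else
        ENNReal.ofReal (abelianTerm (Fintype.card A) (p.count v.1) l) := fun v l => by
    by_cases hl : l = 0
    · rw [if_pos hl, ENNReal.tsum_eq_zero]
      intro x
      simp only [f, ne_eq, hzero x, hl]
      split_ifs <;> rfl
    · rw [if_neg hl, ← tsum_ite_sum_eq_parikhProb_pow]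
      refine tsum_congr fun x => if_ctx_congr Iff.rfl (fun hx => if_pos ?_) fun _ => rfl
      rwa [ne_eq, hzero, hx]
  have hsucc : Function.Injective fun (d : p.toFinset → ℕ) v => d v + 1 :=
    (add_left_injective 1).comp_left
  calc
    _ = ∑' x : p.toFinset → A → ℕ, (∏ v, f v (x v)) *
        (fun l : p.toFinset → ℕ => g (∑ v, p.count v.1 * l v)) fun v => ∑ a, x v a := by
      simp only [f, Finset.prod_ite_zero, Finset.mem_univ, true_imp_iff, ite_mul, zero_mul]
    _ = ∑' l : p.toFinset → ℕ, (∏ v, if l v = 0 then 0 else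
        ENNReal.ofReal (abelianTerm (Fintype.card A) (p.count v.1) (l v))) *
          g (∑ v, p.count v.1 * l v) := by
      simp_rw [← hfiber]
      exact tsum_pi_prod_mul_comp f (fun x => ∑ a, x a) fun l => g (∑ v, p.count v.1 * l v)
    _ = _ := by
      rw [← hsucc.tsum_eq]
      · simp only [Nat.add_one_ne_zero, if_false]
      · intro l hl
        have hl0 : ∀ v, l v ≠ 0 := fun v h =>
          Finset.prod_ne_zero_iff.mp (left_ne_zero_of_mul hl) v (Finset.mem_univ v) (if_pos h)
        exact ⟨fun v => l v - 1, funext fun v => Nat.succ_pred (hl0 v)⟩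

end Mean

section WeightOneCoordinates

theorem tsum_choose_sub_succ (s : ℕ) : ∀ N : ℕ,
    ∑' j : ℕ, ((N - (j + 1)).choose (s + 1) : ℝ≥0∞) = N.choose (s + 2)
  | 0 => by simp
  | N + 1 => by
    rw [tsum_eq_zero_add' ENNReal.summable, Nat.choose_succ_succ, Nat.cast_add,
      ← tsum_choose_sub_succ s N]
    simp only [zero_add, Nat.add_sub_cancel, Nat.add_sub_add_right]

theorem tsum_pi_sub_sum_succ {σ : Type*} [Fintype σ] (N : ℕ) :
    ∑' e : σ → ℕ, ((N - ∑ i, (e i + 1) : ℕ) : ℝ≥0∞) = N.choose (Fintype.card σ + 1) := by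
  have hfin : ∀ s N : ℕ,
      ∑' e : Fin s → ℕ, ((N - ∑ i, (e i + 1) : ℕ) : ℝ≥0∞) = N.choose (s + 1) := fun s => by
    induction s with
    | zero => simp
    | succ s ih =>
      intro N
      rw [← (Fin.consEquiv fun _ => ℕ).tsum_eq, ENNReal.tsum_prod', ← tsum_choose_sub_succ]
      simp_rw [← ih, Nat.sub_sub]
      simp [Fin.consEquiv, Fin.sum_univ_succ]
  have e := Fintype.equivFin σ
  rw [← hfin, ← (e.symm.arrowCongr (Equiv.refl ℕ)).tsum_eq]
  refine tsum_congr fun x => ?_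
  rw [← e.symm.sum_comp]
  simp

theorem tsum_pi_prod_mul_sub_sum {ι : Type*} [Fintype ι] (P : ι → Prop) [DecidablePred P]
    {k : ι → ℕ} (hk : ∀ i, ¬ P i → k i = 1) {t : ι → ℕ → ℝ≥0∞}
    (ht : ∀ i, ¬ P i → ∀ j, t i j = 1) (N : ℕ) :
    ∑' d : ι → ℕ, (∏ i, t i (d i)) * ((N - ∑ i, k i * (d i + 1) : ℕ) : ℝ≥0∞) =
      ∑' d : {i // P i} → ℕ, (∏ i, t i.1 (d i)) *
        ((N - ∑ i, k i.1 * (d i + 1)).choose (Fintype.card {i // ¬ P i} + 1) : ℝ≥0∞) := by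
  rw [← (Equiv.piEquivPiSubtypeProd P fun _ => ℕ).symm.tsum_eq, ENNReal.tsum_prod']
  refine tsum_congr fun d => ?_
  rw [← tsum_pi_sub_sum_succ, ← ENNReal.tsum_mul_left]
  refine tsum_congr fun e => ?_
  rw [← Fintype.prod_subtype_mul_prod_subtype P, ← Fintype.sum_subtype_add_sum_subtype P,
    Nat.sub_sub]
  have hleft : ∀ i : {i // P i}, (Equiv.piEquivPiSubtypeProd P fun _ => ℕ).symm (d, e) i = d i :=
    fun i => dif_pos i.2
  have hright : ∀ i : {i // ¬ P i},
      (Equiv.piEquivPiSubtypeProd P fun _ => ℕ).symm (d, e) i = e i := fun i => dif_neg i.2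
  have hk' : ∀ i : {i // ¬ P i}, k i = 1 := fun i => hk i i.2
  have ht' : ∀ (i : {i // ¬ P i}) j, t i j = 1 := fun i => ht i i.2
  simp only [hleft, hright, hk', ht', one_mul, mul_one, Finset.prod_const_one]

theorem meanAbelianCount_nonneg {V : Type*} (A : Type*) [Fintype A] [DecidableEq A]
    (p : List V) (n : ℕ) : 0 ≤ meanAbelianCount A p n := by
  unfold meanAbelianCount
  positivity

theorem meanAbelianCount_eq_tsum_choose {V A : Type*} [DecidableEq V] [Fintype A]
    [DecidableEq A] [Nonempty A] (p : List V) (n : ℕ) :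
    meanAbelianCount A p n = ∑' d : {v : p.toFinset // 1 < p.count v.1} → ℕ,
      (∏ v, abelianTerm (Fintype.card A) (p.count v.1.1) (d v + 1)) *
        (n + 1 - ∑ v, p.count v.1.1 * (d v + 1)).choose
          (Fintype.card {v : p.toFinset // ¬ 1 < p.count v.1} + 1) := by
  have hone : ∀ v : p.toFinset, ¬ 1 < p.count v.1 → p.count v.1 = 1 := fun v hv =>
    le_antisymm (not_lt.mp hv) (List.count_pos_iff.mpr (List.mem_toFinset.mp v.2))
  rw [← ENNReal.toReal_ofReal (meanAbelianCount_nonneg A p n), ofReal_meanAbelianCount,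
    tsum_isAbelianInstance_eq_tsum_parikh p fun l => (n + 1 - l : ℕ),
    tsum_parikh_eq_tsum_length p fun l => (n + 1 - l : ℕ),
    tsum_pi_prod_mul_sub_sum (fun v : p.toFinset => 1 < p.count v.1) hone (t := fun v l =>
      ENNReal.ofReal (abelianTerm (Fintype.card A) (p.count v.1) (l + 1)))
      fun v hv l => by rw [hone v hv, abelianTerm_one, ENNReal.ofReal_one],
    ENNReal.tsum_toReal_eq fun d => ENNReal.mul_ne_top
      (ENNReal.prod_ne_top fun _ _ => ENNReal.ofReal_ne_top) (ENNReal.natCast_ne_top _)]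
  refine tsum_congr fun d => ?_
  rw [ENNReal.toReal_mul, ENNReal.toReal_prod, ENNReal.toReal_natCast]
  simp only [ENNReal.toReal_ofReal (abelianTerm_nonneg _ _ _)]

end WeightOneCoordinates

section Asymptotics

theorem isEquivalent_natCast_succ_sub (c : ℕ) :
    (fun n : ℕ => ((n + 1 - c : ℕ) : ℝ)) ~[atTop] fun n => (n : ℝ) := by
  have hdiff : (fun n : ℕ => ((n + 1 - c : ℕ) : ℝ) - n) =ᶠ[atTop] fun _ => 1 - (c : ℝ) := by
    filter_upwards [eventually_ge_atTop c] with n hn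
    rw [Nat.cast_sub (by omega), Nat.cast_succ]
    ring
  exact (isLittleO_const_left.mpr
    (Or.inr (tendsto_norm_atTop_atTop.comp tendsto_natCast_atTop_atTop))).congr' hdiff.symm
      (EventuallyEq.refl _ _)

theorem tendsto_choose_sub_div_pow (s c : ℕ) :
    Tendsto (fun n : ℕ => ((n + 1 - c).choose s : ℝ) / (n : ℝ) ^ s) atTop
      (𝓝 (1 / (s.factorial : ℝ))) := by
  have hlim : Tendsto (fun n : ℕ => n + 1 - c) atTop atTop :=
    (tendsto_sub_atTop_nat c).comp (tendsto_add_atTop_nat 1)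
  have hequiv : (fun n : ℕ => ((n + 1 - c).choose s : ℝ)) ~[atTop]
      fun n => (n : ℝ) ^ s / s.factorial :=
    ((isEquivalent_choose s).comp_tendsto hlim).trans
      (((isEquivalent_natCast_succ_sub c).pow s).div IsEquivalent.refl)
  refine (hequiv.div (IsEquivalent.refl (u := fun n : ℕ => (n : ℝ) ^ s))).symm.tendsto_nhds
    (tendsto_const_nhds.congr' ?_)
  filter_upwards [eventually_gt_atTop 0] with n hn
  simp only [Pi.div_apply]
  field_simp

theorem choose_sub_div_pow_le (s c : ℕ) {n : ℕ} (hn : 0 < n) :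
    ((n + 1 - c).choose s : ℝ) / (n : ℝ) ^ s ≤ 2 ^ s := by
  rw [div_le_iff₀ (by positivity), ← mul_pow]
  exact_mod_cast (Nat.choose_le_pow _ _).trans
    (Nat.pow_le_pow_left (by omega : n + 1 - c ≤ 2 * n) s)

theorem tendsto_tsum_mul_choose_sub_div_pow {ι : Type*} {w : ι → ℝ} (hw : Summable w)
    (c : ι → ℕ) (s : ℕ) :
    Tendsto (fun n : ℕ => (∑' d, w d * (n + 1 - c d).choose s) / (n : ℝ) ^ s) atTop
      (𝓝 ((∑' d, w d) / s.factorial)) := by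
  simp_rw [← tsum_div_const, mul_div_assoc, div_eq_mul_one_div (w _) (s.factorial : ℝ)]
  refine tendsto_tsum_of_dominated_convergence (bound := fun d => ‖w d‖ * 2 ^ s)
    (hw.norm.mul_right _) (fun d => (tendsto_choose_sub_div_pow s (c d)).const_mul _) ?_
  filter_upwards [eventually_gt_atTop 0] with n hn d
  rw [norm_mul]
  gcongr
  rw [Real.norm_of_nonneg (by positivity)]
  exact choose_sub_div_pow_le s (c d) hn

@[to_additive]
theorem prod_subtype_coe_eq_prod_filter {V M : Type*} [CommMonoid M] (S : Finset V)
    (P : V → Prop) [DecidablePred P] (f : V → M) :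
    ∏ v : {v : S // P v.1}, f v.1.1 = ∏ v ∈ S.filter P, f v := by
  rw [Finset.prod_filter, ← Finset.prod_coe_sort S, ← Finset.prod_filter]
  exact (Finset.prod_subtype _ (fun v => by simp) fun v : S => f v.1).symm

theorem tendsto_meanAbelianCount_div_pow {V A : Type*} [DecidableEq V] [Fintype A]
    [DecidableEq A] [Nonempty A] {p : List V}
    (hp : ∀ v ∈ p.toFinset, 1 < p.count v →
      Summable fun ℓ : ℕ => abelianTerm (Fintype.card A) (p.count v) (ℓ + 1))
    {s : ℕ} (hs : s = (p.toFinset.filter fun v => p.count v = 1).card) :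
    Tendsto (fun n : ℕ => meanAbelianCount A p n / (n : ℝ) ^ (s + 1)) atTop
      (𝓝 ((∏ v ∈ p.toFinset.filter (fun v => 1 < p.count v),
        ∑' ℓ : ℕ, abelianTerm (Fintype.card A) (p.count v) (ℓ + 1)) / (s + 1).factorial)) := by
  have hcard : Fintype.card {v : p.toFinset // ¬ 1 < p.count v.1} = s := by
    rw [hs, Fintype.card_eq_sum_ones, Finset.card_eq_sum_ones,
      sum_subtype_coe_eq_sum_filter p.toFinset (fun v => ¬ 1 < p.count v) fun _ => 1]
    congr 1
    refine Finset.filter_congr fun v hv => ?_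
    have := List.count_pos_iff.mpr (List.mem_toFinset.mp hv)
    omega
  have hprod := hasSum_pi_prod
    (t := fun (v : {v : p.toFinset // 1 < p.count v.1}) ℓ =>
      abelianTerm (Fintype.card A) (p.count v.1.1) (ℓ + 1))
    (fun _ _ => abelianTerm_nonneg _ _ _) fun v => hp v.1.1 v.1.2 v.2
  have hlim := tendsto_tsum_mul_choose_sub_div_pow hprod.summable
    (fun d => ∑ v, p.count v.1.1 * (d v + 1)) (s + 1)
  simp_rw [← hcard, ← meanAbelianCount_eq_tsum_choose, hcard] at hlim
  rwa [hprod.tsum_eq, prod_subtype_coe_eq_prod_filter p.toFinset (fun v => 1 < p.count v) fun v =>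
    ∑' ℓ : ℕ, abelianTerm (Fintype.card A) (p.count v) (ℓ + 1)] at hlim

theorem isEquivalent_meanAbelianCount {V A : Type*} [DecidableEq V] [Fintype A] [DecidableEq A]
    [Nonempty A] {p : List V}
    (hp : ∀ v ∈ p.toFinset, 1 < p.count v →
      Summable fun ℓ : ℕ => abelianTerm (Fintype.card A) (p.count v) (ℓ + 1))
    {s : ℕ} (hs : s = (p.toFinset.filter fun v => p.count v = 1).card) :
    (fun n : ℕ => meanAbelianCount A p n) ~[atTop] fun n : ℕ =>
      (n : ℝ) ^ (s + 1) / ((s + 1).factorial : ℝ) *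
        ∏ v ∈ p.toFinset.filter (fun v => 1 < p.count v),
          ∑' ℓ : ℕ, abelianTerm (Fintype.card A) (p.count v) (ℓ + 1) := by
  have hlim := tendsto_meanAbelianCount_div_pow hp hs
  have hpos : 0 < ∏ v ∈ p.toFinset.filter (fun v => 1 < p.count v),
      ∑' ℓ : ℕ, abelianTerm (Fintype.card A) (p.count v) (ℓ + 1) :=
    Finset.prod_pos fun v hv => by
      obtain ⟨hmem, hcount⟩ := Finset.mem_filter.mp hv
      exact (hp v hmem hcount).tsum_pos (fun _ => abelianTerm_nonneg _ _ _) 0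
        (abelianTerm_pos _ _ _)
  set P := ∏ v ∈ p.toFinset.filter (fun v => 1 < p.count v),
    ∑' ℓ : ℕ, abelianTerm (Fintype.card A) (p.count v) (ℓ + 1)
  refine isEquivalent_of_tendsto_one ?_
  have hone := hlim.div_const (P / (s + 1).factorial)
  rw [div_self (by positivity)] at hone
  refine hone.congr fun n => ?_
  rw [Pi.div_apply, div_div, div_mul_eq_mul_div, mul_div_assoc]

end Asymptotics

section Summability

theorem factorial_mul_succ_pow_le (q i : ℕ) :
    q.factorial * (q + 1) ^ i ≤ i.factorial * (q + 1) ^ q := by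
  -- The ratio `i ! / (q + 1) ^ i` decreases in `i` up to `i = q` and increases afterwards.
  rcases le_total q i with h | h
  · obtain ⟨j, rfl⟩ := Nat.exists_eq_add_of_le h
    rw [pow_add, mul_comm ((q + 1) ^ q), ← mul_assoc]
    exact Nat.mul_le_mul_right _ Nat.factorial_mul_pow_le_factorial
  · obtain ⟨j, rfl⟩ := Nat.exists_eq_add_of_le h
    rw [← Nat.factorial_mul_ascFactorial, pow_add, mul_assoc, mul_comm (_ ^ i)]
    gcongr
    exact (Nat.ascFactorial_le_pow_add i j).trans (Nat.pow_le_pow_left (by omega) j)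

theorem factorial_pow_mul_succ_pow_le_prod_factorial {ι : Type*} {S : Finset ι} {x : ι → ℕ}
    {q r : ℕ} (hx : ∑ i ∈ S, x i = S.card * q + r) :
    q.factorial ^ S.card * (q + 1) ^ r ≤ ∏ i ∈ S, (x i).factorial := by
  have hprod := Finset.prod_le_prod' fun i (_ : i ∈ S) => factorial_mul_succ_pow_le q (x i)
  simp only [Finset.prod_mul_distrib, Finset.prod_const, Finset.prod_pow_eq_pow_sum, hx] at hprod
  refine Nat.le_of_mul_le_mul_right (c := (q + 1) ^ (S.card * q)) ?_ (by positivity)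
  calc
    _ = q.factorial ^ S.card * (q + 1) ^ (S.card * q + r) := by ring
    _ ≤ _ := hprod
    _ = _ := by ring

theorem multinomial_mul_factorial_pow_le {ι : Type*} {S : Finset ι} {x : ι → ℕ} {q r : ℕ}
    (hr : r ≤ S.card) (hx : ∑ i ∈ S, x i = S.card * q + r) :
    Nat.multinomial S x * q.factorial ^ S.card ≤ (S.card * q).factorial * S.card ^ r := by
  refine Nat.le_of_mul_le_mul_right (c := (q + 1) ^ r) ?_ (by positivity)
  calc
    _ = Nat.multinomial S x * (q.factorial ^ S.card * (q + 1) ^ r) := by ring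
    _ ≤ Nat.multinomial S x * ∏ i ∈ S, (x i).factorial :=
      Nat.mul_le_mul_left _ (factorial_pow_mul_succ_pow_le_prod_factorial hx)
    _ = (S.card * q + r).factorial := by rw [mul_comm, Nat.multinomial_spec, hx]
    _ ≤ (S.card * q).factorial * (S.card * q + r) ^ r := by
      rw [← Nat.factorial_mul_ascFactorial]
      exact Nat.mul_le_mul_left _ (Nat.ascFactorial_le_pow_add _ _)
    _ ≤ (S.card * q).factorial * (S.card * (q + 1)) ^ r := by
      rw [mul_add_one]
      gcongr
    _ = _ := by rw [mul_pow, mul_assoc]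

theorem factorial_le_stirling {n : ℕ} (hn : n ≠ 0) :
    (n.factorial : ℝ) ≤ Real.exp 1 * √n * (n / Real.exp 1) ^ n := by
  obtain ⟨j, rfl⟩ := Nat.exists_eq_succ_of_ne_zero hn
  have h := Stirling.stirlingSeq'_antitone (Nat.zero_le j)
  simp only [Function.comp_apply, Nat.succ_eq_add_one, zero_add, Stirling.stirlingSeq_one] at h
  rw [Stirling.stirlingSeq, div_le_iff₀ (by positivity), Real.sqrt_mul zero_le_two] at h
  refine h.trans_eq ?_
  field_simp

theorem sqrt_mul_div_exp_pow_le_factorial (n : ℕ) :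
    √n * (n / Real.exp 1) ^ n ≤ n.factorial := by
  refine le_trans ?_ (Stirling.le_factorial_stirling n)
  gcongr
  exact le_mul_of_one_le_left n.cast_nonneg (by linarith [Real.pi_gt_three])

theorem factorial_mul_div_le {m q : ℕ} (hm : m ≠ 0) (hq : q ≠ 0) :
    ((m * q).factorial : ℝ) / ((q.factorial : ℝ) ^ m * (m : ℝ) ^ (m * q)) ≤
      Real.exp 1 * √m / √q ^ (m - 1) := by
  have hsqrt : √(q : ℝ) ^ m = √q ^ (m - 1) * √q := (pow_sub_one_mul hm _).symm
  rw [div_le_div_iff₀ (by positivity) (by positivity)]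
  calc
    ((m * q).factorial : ℝ) * √q ^ (m - 1)
      ≤ Real.exp 1 * √(m * q : ℕ) * ((m * q : ℕ) / Real.exp 1) ^ (m * q) * √q ^ (m - 1) := by
        gcongr
        exact factorial_le_stirling (mul_ne_zero hm hq)
    _ = Real.exp 1 * √m * ((√q * (q / Real.exp 1) ^ q) ^ m * (m : ℝ) ^ (m * q)) := by
        rw [Nat.cast_mul, Real.sqrt_mul m.cast_nonneg, mul_div_assoc, mul_pow, mul_pow, hsqrt,
          ← pow_mul, mul_comm q m]
        ring
    _ ≤ Real.exp 1 * √m * ((q.factorial : ℝ) ^ m * (m : ℝ) ^ (m * q)) := by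
        gcongr
        exact sqrt_mul_div_exp_pow_le_factorial q

section ParikhProbBound

variable {ι : Type*} [Fintype ι] {x : ι → ℕ}

theorem parikhProb_le_factorial_mul_div {q r : ℕ} (hr : r ≤ Fintype.card ι)
    (hx : ∑ a, x a = Fintype.card ι * q + r) :
    parikhProb x ≤ ((Fintype.card ι * q).factorial : ℝ) /
      ((q.factorial : ℝ) ^ Fintype.card ι * (Fintype.card ι : ℝ) ^ (Fintype.card ι * q)) := by
  cases isEmpty_or_nonempty ι
  · simp [parikhProb]
  have hmul : (Nat.multinomial Finset.univ x : ℝ) * (q.factorial : ℝ) ^ Fintype.card ι ≤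
      (Fintype.card ι * q).factorial * (Fintype.card ι : ℝ) ^ r := by
    exact_mod_cast multinomial_mul_factorial_pow_le hr hx
  rw [parikhProb, hx, pow_add, div_le_div_iff₀ (by positivity) (by positivity)]
  calc
    _ = (Nat.multinomial Finset.univ x : ℝ) * (q.factorial : ℝ) ^ Fintype.card ι *
        (Fintype.card ι : ℝ) ^ (Fintype.card ι * q) := (mul_assoc _ _ _).symm
    _ ≤ (Fintype.card ι * q).factorial * (Fintype.card ι : ℝ) ^ r *
        (Fintype.card ι : ℝ) ^ (Fintype.card ι * q) := by gcongr
    _ = _ := by ring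

theorem parikhProb_le [Nonempty ι] (hx : Fintype.card ι ≤ ∑ a, x a) :
    parikhProb x ≤ Real.exp 1 * √(Fintype.card ι) *
      √(2 * Fintype.card ι) ^ (Fintype.card ι - 1) /
        √(∑ a, x a : ℕ) ^ (Fintype.card ι - 1) := by
  have hcard : 0 < Fintype.card ι := Fintype.card_pos
  have hmod := Nat.mod_lt (∑ a, x a) hcard
  have hdiv := Nat.div_add_mod (∑ a, x a) (Fintype.card ι)
  have hq : 0 < (∑ a, x a) / Fintype.card ι := Nat.div_pos hx hcard
  refine (parikhProb_le_factorial_mul_div hmod.le hdiv.symm).trans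
    ((factorial_mul_div_le hcard.ne' hq.ne').trans ?_)
  have hle : ∑ a, x a ≤ 2 * Fintype.card ι * ((∑ a, x a) / Fintype.card ι) := by nlinarith
  have hsum : 0 < ∑ a, x a := hcard.trans_le hx
  rw [div_le_div_iff₀ (by positivity) (by positivity), mul_assoc (Real.exp 1 * _), ← mul_pow,
    ← Real.sqrt_mul (by positivity)]
  gcongr
  exact_mod_cast hle

end ParikhProbBound

theorem summable_abelianTerm {m k : ℕ} (h : 2 < (m - 1) * (k - 1)) :
    Summable fun ℓ : ℕ => abelianTerm m k (ℓ + 1) := by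
  have hm : NeZero m := ⟨fun hm => by simp [hm] at h⟩
  obtain ⟨k, rfl⟩ : ∃ j, k = j + 1 := Nat.exists_eq_succ_of_ne_zero fun hk => by simp [hk] at h
  rw [Nat.add_sub_cancel] at h
  let C : ℝ := Real.exp 1 * √m * √(2 * m) ^ (m - 1)
  have hexp : 1 < (((m - 1) * k : ℕ) : ℝ) / 2 := by
    rw [one_lt_div two_pos]
    exact_mod_cast h
  rw [summable_nat_add_iff (f := fun ℓ => abelianTerm m (k + 1) ℓ) 1]
  refine Summable.of_norm_bounded_eventually_nat
    ((Real.summable_one_div_nat_rpow.mpr hexp).mul_left (C ^ k)) ?_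
  filter_upwards [eventually_ge_atTop m] with ℓ hℓ
  have hsqrt : (√ℓ ^ (m - 1)) ^ k = (ℓ : ℝ) ^ ((((m - 1) * k : ℕ) : ℝ) / 2) := by
    rw [← pow_mul, Real.sqrt_eq_rpow, ← Real.rpow_natCast, ← Real.rpow_mul ℓ.cast_nonneg,
      one_div_mul_eq_div]
  rw [Real.norm_of_nonneg (abelianTerm_nonneg _ _ _), ← hsqrt, mul_one_div, ← div_pow]
  refine abelianTerm_succ_le_pow fun x hx => ?_
  subst hx
  simpa only [Fintype.card_fin] using parikhProb_le (x := x) (by rwa [Fintype.card_fin])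

end Summability

theorem mainTheorem4_general {V A : Type*} [DecidableEq V] [Fintype A] [DecidableEq A]
    [Nonempty A] (p : List V)
    (hp : ∀ v ∈ p.toFinset, 1 < p.count v → 2 < (Fintype.card A - 1) * (p.count v - 1))
    (s : ℕ) (hs : s = (p.toFinset.filter (fun v => p.count v = 1)).card) :
    (∀ v ∈ p.toFinset, 1 < p.count v →
      Summable (fun ℓ : ℕ => abelianTerm (Fintype.card A) (p.count v) (ℓ + 1))) ∧
    Asymptotics.IsEquivalent Filter.atTop
      (fun n : ℕ => meanAbelianCount A p n)
      (fun n : ℕ => (n : ℝ) ^ (s + 1) / (Nat.factorial (s + 1) : ℝ) *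
        ∏ v ∈ p.toFinset.filter (fun v => 1 < p.count v),
          ∑' ℓ : ℕ, abelianTerm (Fintype.card A) (p.count v) (ℓ + 1)) := by
  have hsum : ∀ v ∈ p.toFinset, 1 < p.count v →
      Summable (fun ℓ : ℕ => abelianTerm (Fintype.card A) (p.count v) (ℓ + 1)) :=
    fun v hv hcount => summable_abelianTerm (hp v hv hcount)
  exact ⟨hsum, isEquivalent_meanAbelianCount hsum hs⟩

/-- Here `p.toFinset` is the set of variables that occur in `p`, the variable `v` occurs
`p.count v` times, and `s` is the number of variables that occur exactly once. The convergence
of the series in the product is part of the claim; `ℓ + 1` runs over the integers `≥ 1`. -/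
theorem mainTheorem4 {V A : Type*} [DecidableEq V] [Fintype A] [DecidableEq A]
    (m : ℕ) (hm : 4 ≤ m) (hA : Fintype.card A = m) (p : List V)
    (s : ℕ) (hs : s = (p.toFinset.filter (fun v => p.count v = 1)).card) :
    (∀ v ∈ p.toFinset, 1 < p.count v →
      Summable (fun ℓ : ℕ => abelianTerm m (p.count v) (ℓ + 1))) ∧
    Asymptotics.IsEquivalent Filter.atTop
      (fun n : ℕ => meanAbelianCount A p n)
      (fun n : ℕ => (n : ℝ) ^ (s + 1) / (Nat.factorial (s + 1) : ℝ) *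
        ∏ v ∈ p.toFinset.filter (fun v => 1 < p.count v),
          ∑' ℓ : ℕ, abelianTerm m (p.count v) (ℓ + 1)) := by
  subst hA
  have : Nonempty A := Fintype.card_pos_iff.mp (by omega)
  exact mainTheorem4_general p (fun v _ hv => (by norm_num : 2 < 3 * 1).trans_le
    (Nat.mul_le_mul (by omega) (by omega))) s hs
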